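/- There is an absolute constant $c>0$ such that for every $m\ge 0$ and every partial Boolean function $g\subseteq\{0,1\}^m\times\{0,1\}$, \[ \chi(g)\ \ge\ c\,\sqrt{R_{1/3}(g)}\qquad\text{and}\qquad \bar\chi(g)\ \ge\ c\,\sqrt{R_{1/3}(g)} . \] Here $g^{-1}(b)$ is the set of $x\in\{0,1\}^m$ with $(x,b)\in g$ and $(x,1-b)\notin g$; a partial Boolean function is a relation $g$ such that $(x,0),(x,1)\in g$ for every $x\notin g^{-1}(0)\cup g^{-1}(1)$. A deterministic decision tree $T$ computes $g$ if $(x,T(x))\in g$ for all $x\in\{0,1\}^m$. $R_{1/3}(g)$ is the least $\ell$ for which some probability distribution over deterministic decision trees, each making at most $\ell$ queries on every input, satisfies $\Pr_T[(x,T(x))\in g]\ge 2/3$ for all $x\in\{0,1\}^m$. Let $\mu_0,\mu_1$ be probability distributions supported on $g^{-1}(0),g^{-1}(1)$, and let $T$ be a decision tree computing $g$. For an internal vertex $v$ of $T$ let $q(v)$ be the index queried at $v$, $d_T(v)$ the number of vertices on the path from the root to $v$ (the root has depth $1$), $p_b(v)=\Pr_{x\sim\mu_b}[x_{q(v)}=0\mid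 x\text{ reaches }v]$, and $\Delta(v)=|p_0(v)-p_1(v)|$. Let $R(v)=1$ if $v$ is the root and $R(v)=R(u)\cdot\min_{b\in\{0,1\}}\Pr_{x\sim\mu_b}[x\text{ reaches }v\mid x\text{ reaches }u]$ if $v$ has parent $u$. (Conditional probabilities given an event of probability zero are taken to be $0$; they only occur where $R$ vanishes.) Put $\chi(T,(\mu_0,\mu_1))=\sum_{v}d_T(v)\,\Delta(v)\,R(v)$, the sum being over the internal vertices of $T$. The conflict complexity is $\chi(g)=\max_{(\mu_0,\mu_1)}\min_T\chi(T,(\mu_0,\mu_1))$, and the max conflict complexity is $\bar\chi(g)=\max_{\mathcal Q}\min_T\mathbb E_{(\mu_0,\mu_1)\sim\mathcal Q}[\chi(T,(\mu_0,\mu_1))]$. Here $(\mu_0,\mu_1)$ ranges over all pairs of distributions supported on $g^{-1}(0)$ and $g^{-1}(1)$ respectively, $\mathcal Q$ over all probability distributions on such pairs, and $T$ over all deterministic decision trees computing $g$ (maxima and minima are read as suprema and infima). Both quantities are $0$ if $g^{-1}(0)$ or $g^{-1}(1)$ is empty. -/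

import Mathlib

open MeasureTheory
open scoped ENNReal

noncomputable section

/-- Deterministic query algorithms on `m`-bit inputs with outputs in `S`, as binary decision trees:
`query i T₀ T₁` queries the bit `x i`, and continues with `T₀` if it is `0` (`false`) and with
`T₁` if it is `1` (`true`). -/
inductive DecisionTree (m : ℕ) (S : Type) : Type where
  | leaf (s : S) : DecisionTree m S
  | query (i : Fin m) (T₀ T₁ : DecisionTree m S) : DecisionTree m S

namespace DecisionTree

variable {m : ℕ} {S : Type}

/-- The output of the tree on input `x`. -/
def output : DecisionTree m S → (Fin m → Bool) → S
  | leaf s, _ => s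
  | query i T₀ T₁, x => if x i then T₁.output x else T₀.output x

/-- The number of queries that the tree makes on input `x`. -/
def numQueries : DecisionTree m S → (Fin m → Bool) → ℕ
  | leaf _, _ => 0
  | query i T₀ T₁, x => 1 + (if x i then T₁.numQueries x else T₀.numQueries x)

/-- The tree computes the relation `h`. -/
def Computes (T : DecisionTree m S) (h : Set ((Fin m → Bool) × S)) : Prop :=
  ∀ x, (x, T.output x) ∈ h

end DecisionTree

/-- A randomized query algorithm, i.e. a probability distribution `A` over deterministic query
algorithms, computes the relation `h` with error `ε`. -/
def RandComputes {m : ℕ} {S : Type} (A : PMF (DecisionTree m S)) (h : Set ((Fin m → Bool) × S))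
    (ε : ℝ) : Prop :=
  ∀ x, ENNReal.ofReal (1 - ε) ≤ A.toOuterMeasure {T | (x, T.output x) ∈ h}

/-- The bounded-error randomized query complexity `R_ε(h)`: the least worst-case number of queries,
over all inputs and all internal randomness, of a randomized query algorithm that computes `h`
with error `ε`. -/
def randQueryComplexity {m : ℕ} {S : Type} (ε : ℝ) (h : Set ((Fin m → Bool) × S)) : ℕ :=
  sInf {l : ℕ | ∃ A : PMF (DecisionTree m S),
    RandComputes A h ε ∧ ∀ T ∈ A.support, ∀ x, T.numQueries x ≤ l}

/-- `g⁻¹(b)`: the strings for which `b` is the only correct output. -/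
def validPreimage {m : ℕ} (g : Set ((Fin m → Bool) × Bool)) (b : Bool) : Set (Fin m → Bool) :=
  {x | (x, b) ∈ g ∧ (x, !b) ∉ g}

/-- A partial Boolean function is a relation in which both outputs are correct for every string
that is not a valid input. -/
def IsPartialBoolFun {m : ℕ} (g : Set ((Fin m → Bool) × Bool)) : Prop :=
  ∀ x, x ∉ validPreimage g false ∪ validPreimage g true → (x, false) ∈ g ∧ (x, true) ∈ g

/-- Probability distributions on `{0,1}^m`, given by their weights. They form a subspace of
`ℝ^(2^m)`, and carry its (Borel) measurable structure. -/
abbrev Distr (m : ℕ) : Type := stdSimplex ℝ (Fin m → Bool)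

/-- The support of `μ` is contained in `A`. -/
def Distr.SupportedOn {m : ℕ} (μ : Distr m) (A : Set (Fin m → Bool)) : Prop :=
  ∀ x, μ.1 x ≠ 0 → x ∈ A

/-- `Pr_{x ∼ μ}[x ∈ C]`. -/
def Distr.prob {m : ℕ} (μ : Distr m) (C : Set (Fin m → Bool)) : ℝ :=
  ∑ x, C.indicator μ.1 x

/-- `Pr_{x ∼ μ}[x_i = b ∣ x ∈ C]` (it is `0` if `Pr_{x ∼ μ}[x ∈ C] = 0`). -/
def Distr.condBit {m : ℕ} (μ : Distr m) (C : Set (Fin m → Bool)) (i : Fin m) (b : Bool) : ℝ :=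
  μ.prob (C ∩ {x | x i = b}) / μ.prob C

/-- The sum of `d(v) Δ(v) R(v)` over all (non-leaf) vertices `v` of a subtree. The first argument
is the subtree; `C`, `d`, `r` are the subcube of the inputs that reach its root `v`, the depth
`d(v)` and the value `R(v)`. The two children have depth `d(v) + 1`, and the child for the answer
`b` has `R`-value `R(v) · min {Pr_{μ₀}[x_{q(v)} = b ∣ x at v], Pr_{μ₁}[x_{q(v)} = b ∣ x at v]}`.
(If `v` has probability `0` under `μ₀` or `μ₁`, then `R(v) = 0`.) -/
def conflictSum {m : ℕ} (μ₀ μ₁ : Distr m) :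
    DecisionTree m Bool → Set (Fin m → Bool) → ℕ → ℝ → ℝ
  | .leaf _, _, _, _ => 0
  | .query i T₀ T₁, C, d, r =>
      d * |μ₀.condBit C i false - μ₁.condBit C i false| * r
      + conflictSum μ₀ μ₁ T₀ (C ∩ {x | x i = false}) (d + 1)
          (r * min (μ₀.condBit C i false) (μ₁.condBit C i false))
      + conflictSum μ₀ μ₁ T₁ (C ∩ {x | x i = true}) (d + 1)
          (r * min (μ₀.condBit C i true) (μ₁.condBit C i true))

/-- `χ(T, (μ₀, μ₁)) = ∑_{v ∈ T} d_T(v) Δ(v) R(v)`. The root has depth `1` and `R`-value `1`. -/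
def treeConflict {m : ℕ} (T : DecisionTree m Bool) (μ₀ μ₁ : Distr m) : ℝ :=
  conflictSum μ₀ μ₁ T Set.univ 1 1

/-- The conflict complexity `χ(g) = max_{μ₀, μ₁} min_T χ(T, (μ₀, μ₁))`, over the distributions `μ₀`
on `g⁻¹(0)` and `μ₁` on `g⁻¹(1)` and the trees `T` that compute `g`. It is `0` if one of
`g⁻¹(0)`, `g⁻¹(1)` is empty. -/
def conflictComplexity {m : ℕ} (g : Set ((Fin m → Bool) × Bool)) : ℝ≥0∞ :=
  ⨆ (μ₀ : Distr m) (μ₁ : Distr m)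
    (_ : μ₀.SupportedOn (validPreimage g false)) (_ : μ₁.SupportedOn (validPreimage g true)),
  ⨅ (T : DecisionTree m Bool) (_ : T.Computes g), ENNReal.ofReal (treeConflict T μ₀ μ₁)

/-- `Q`, a distribution over pairs of distributions, is consistent with `g`: almost every pair
consists of a distribution on `g⁻¹(0)` and one on `g⁻¹(1)`. -/
def ConsistentWith {m : ℕ} (Q : ProbabilityMeasure (Distr m × Distr m))
    (g : Set ((Fin m → Bool) × Bool)) : Prop :=
  ∀ᵐ p ∂(Q : Measure (Distr m × Distr m)),
    p.1.SupportedOn (validPreimage g false) ∧ p.2.SupportedOn (validPreimage g true)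

/-- The max conflict complexity
`max_Q min_T E_{(μ₀, μ₁) ∼ Q} [χ(T, (μ₀, μ₁))]`, over the distributions `Q` over pairs that are
consistent with `g` and the trees `T` that compute `g`. -/
def maxConflictComplexity {m : ℕ} (g : Set ((Fin m → Bool) × Bool)) : ℝ≥0∞ :=
  ⨆ (Q : ProbabilityMeasure (Distr m × Distr m)) (_ : ConsistentWith Q g),
  ⨅ (T : DecisionTree m Bool) (_ : T.Computes g),
    ∫⁻ p, ENNReal.ofReal (treeConflict T p.1 p.2) ∂(Q : Measure (Distr m × Distr m))

end

/-!
Let `μ₀`, `μ₁` be distributions on `g⁻¹(0)`, `g⁻¹(1)`. The affinity `√(μ₀(C) μ₁(C))` of the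
subcubes `C` at the vertices of a decision tree behaves like a Hellinger integral: it is at least
`R(v)`, it vanishes at the leaves of a tree that computes `g`, and a query at `v` decreases its
total by at least `Δ(v)² R(v) / 2`. If `χ(T, (μ₀, μ₁)) ≤ (k + 1) / 2`, then `∑ Δ(v) R(v) ≥ 1 / 2`
over the first `k` levels of `T`, where `∑ R(v) ≤ k`; hence by Cauchy-Schwarz these `k` queries
decrease the affinity by a factor `1 - 1 / (8k)`. Against an arbitrary input distribution,
conditioning on the outcome of every round and using a new tree for the next one, `16k` rounds
bring the error below `e⁻² ≤ 1 / 3`. Yao's principle turns these trees into a randomized algorithm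
with `16k²` queries.
-/

section Minimax

open scoped Matrix

variable {ι κ : Type*} [Fintype ι] [Fintype κ]

lemma exists_mem_stdSimplex_forall_le_mulVec [Nonempty ι] (M : Matrix ι κ ℝ) {v : ℝ}
    (h : ∀ p ∈ stdSimplex ℝ ι, ∃ j, v ≤ (p ᵥ* M) j) :
    ∃ q ∈ stdSimplex ℝ κ, ∀ i, v ≤ (M *ᵥ q) i := by
  classical
  let B : (ι → ℝ) →ₗ[ℝ] (κ → ℝ) →ₗ[ℝ] ℝ := Matrix.toLinearMap₂' ℝ M
  have hB (p : ι → ℝ) (q : κ → ℝ) : B p q = p ⬝ᵥ M *ᵥ q := Matrix.toLinearMap₂'_apply' M p q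
  have hι : (stdSimplex ℝ ι).Nonempty := ⟨_, single_mem_stdSimplex ℝ (Classical.arbitrary ι)⟩
  have hκ : (stdSimplex ℝ κ).Nonempty :=
    have ⟨j, _⟩ := h _ hι.some_mem
    ⟨_, single_mem_stdSimplex ℝ j⟩
  obtain ⟨p, hp, q, hq, hpq⟩ := Sion.exists_isSaddlePointOn (f := fun p q => B p q)
    hι (convex_stdSimplex ℝ ι) (isCompact_stdSimplex ℝ ι)
    (fun q _ =>
      (B.flip q).continuous_of_finiteDimensional.lowerSemicontinuous.lowerSemicontinuousOn _)
    (fun q _ => ((B.flip q).convexOn (convex_stdSimplex ℝ ι)).quasiconvexOn)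
    (convex_stdSimplex ℝ κ) hκ (isCompact_stdSimplex ℝ κ)
    (fun p _ => (B p).continuous_of_finiteDimensional.upperSemicontinuous.upperSemicontinuousOn _)
    (fun p _ => ((B p).concaveOn (convex_stdSimplex ℝ κ)).quasiconcaveOn)
  obtain ⟨j, hj⟩ := h p hp
  refine ⟨q, hq, fun i => ?_⟩
  calc
    v ≤ B p (Pi.single j 1) := by
      rw [hB, Matrix.dotProduct_mulVec, dotProduct_single_one]
      exact hj
    _ ≤ B (Pi.single i 1) q :=
      hpq _ (single_mem_stdSimplex ℝ i) _ (single_mem_stdSimplex ℝ j)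
    _ = (M *ᵥ q) i := by rw [hB, single_one_dotProduct]

end Minimax

/-- The error set of a tree for the relation `h`: the inputs on which its output is not allowed
by `h`. -/
def DecisionTree.errorSet {m : ℕ} {S : Type} (T : DecisionTree m S)
    (h : Set ((Fin m → Bool) × S)) : Set (Fin m → Bool) :=
  {x | (x, T.output x) ∉ h}

namespace Distr

variable {m : ℕ} (μ : Distr m)

lemma prob_nonneg (C : Set (Fin m → Bool)) : 0 ≤ μ.prob C :=
  Finset.sum_nonneg fun x _ => Set.indicator_nonneg (fun y _ => μ.2.1 y) x

lemma prob_univ : μ.prob Set.univ = 1 := by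
  simpa only [prob, Set.indicator_univ] using μ.2.2

lemma prob_mono {C D : Set (Fin m → Bool)} (h : C ⊆ D) : μ.prob C ≤ μ.prob D :=
  Finset.sum_le_sum fun x _ => Set.indicator_le_indicator_of_subset h μ.2.1 x

lemma prob_le_one (C : Set (Fin m → Bool)) : μ.prob C ≤ 1 :=
  (μ.prob_mono C.subset_univ).trans_eq μ.prob_univ

lemma prob_inter_add_prob_inter_compl (C D : Set (Fin m → Bool)) :
    μ.prob (C ∩ D) + μ.prob (C ∩ Dᶜ) = μ.prob C := by
  simp only [prob, ← Finset.sum_add_distrib]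
  refine Finset.sum_congr rfl fun x _ => ?_
  rw [Set.inter_comm, Set.inter_comm C, ← Set.indicator_indicator, ← Set.indicator_indicator]
  exact Set.indicator_self_add_compl_apply D _ x

lemma prob_compl (C : Set (Fin m → Bool)) : μ.prob Cᶜ = 1 - μ.prob C := by
  have h := μ.prob_inter_add_prob_inter_compl Set.univ C
  rw [Set.univ_inter, Set.univ_inter, prob_univ] at h
  linarith

lemma prob_inter_false_add_true (C : Set (Fin m → Bool)) (i : Fin m) :
    μ.prob (C ∩ {x | x i = false}) + μ.prob (C ∩ {x | x i = true}) = μ.prob C := by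
  have hc : {x : Fin m → Bool | x i = true} = {x | x i = false}ᶜ := by ext x; simp
  rw [hc, prob_inter_add_prob_inter_compl]

lemma prob_inter_errorSet_query {S : Type} (h : Set ((Fin m → Bool) × S))
    (C : Set (Fin m → Bool)) (i : Fin m) (T₀ T₁ : DecisionTree m S) :
    μ.prob (C ∩ (DecisionTree.query i T₀ T₁).errorSet h) =
      μ.prob (C ∩ {x | x i = false} ∩ T₀.errorSet h)
        + μ.prob (C ∩ {x | x i = true} ∩ T₁.errorSet h) := by
  rw [← prob_inter_false_add_true _ _ i]
  congr 2 <;>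
  · ext x
    cases hi : x i <;> simp [DecisionTree.errorSet, DecisionTree.output, hi]

variable {μ} in
lemma SupportedOn.prob_eq_zero {A C : Set (Fin m → Bool)} (h : μ.SupportedOn A)
    (hAC : Disjoint A C) : μ.prob C = 0 :=
  Finset.sum_eq_zero fun x _ => Set.indicator_apply_eq_zero.2 fun hx =>
    by_contra fun hne => hAC.notMem_of_mem_left (h x hne) hx

lemma condBit_nonneg (C : Set (Fin m → Bool)) (i : Fin m) (b : Bool) : 0 ≤ μ.condBit C i b :=
  div_nonneg (μ.prob_nonneg _) (μ.prob_nonneg _)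

lemma condBit_mul_prob (C : Set (Fin m → Bool)) (i : Fin m) (b : Bool) :
    μ.condBit C i b * μ.prob C = μ.prob (C ∩ {x | x i = b}) :=
  div_mul_cancel_of_imp fun h =>
    le_antisymm (h ▸ μ.prob_mono Set.inter_subset_left) (μ.prob_nonneg _)

lemma condBit_false_add_true {C : Set (Fin m → Bool)} (h : μ.prob C ≠ 0) (i : Fin m) :
    μ.condBit C i false + μ.condBit C i true = 1 := by
  rw [condBit, condBit, ← add_div, prob_inter_false_add_true, div_self h]

/-- The point mass at `x`. -/
def dirac (x : Fin m → Bool) : Distr m :=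
  ⟨Pi.single x 1, single_mem_stdSimplex ℝ x⟩

lemma supportedOn_dirac {x : Fin m → Bool} {A : Set (Fin m → Bool)} (hx : x ∈ A) :
    (dirac x).SupportedOn A := fun y hy =>
  have hyx : y = x := by_contra fun h => hy (Pi.single_eq_of_ne h _)
  hyx ▸ hx

/-- The conditional distribution `μ(· ∣ A)`, for an event `A` of positive probability. -/
noncomputable def cond (A : Set (Fin m → Bool)) (hA : μ.prob A ≠ 0) : Distr m :=
  ⟨fun x => A.indicator μ.1 x / μ.prob A,
    fun x => div_nonneg (Set.indicator_nonneg (fun y _ => μ.2.1 y) x) (μ.prob_nonneg A), by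
    rw [← Finset.sum_div]
    exact div_self hA⟩

variable {A : Set (Fin m → Bool)} (hA : μ.prob A ≠ 0)

lemma prob_mul_prob_cond (C : Set (Fin m → Bool)) :
    μ.prob A * (μ.cond A hA).prob C = μ.prob (C ∩ A) := by
  unfold prob
  rw [Finset.mul_sum]
  refine Finset.sum_congr rfl fun x _ => ?_
  rw [← Set.indicator_indicator]
  by_cases hx : x ∈ C
  · rw [Set.indicator_of_mem hx, Set.indicator_of_mem hx]
    exact mul_div_cancel₀ _ hA
  · rw [Set.indicator_of_notMem hx, Set.indicator_of_notMem hx, mul_zero]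

lemma supportedOn_cond : (μ.cond A hA).SupportedOn A := fun _ hx =>
  Set.mem_of_indicator_ne_zero (div_ne_zero_iff.1 hx).1

end Distr

section Yao

open scoped Matrix

variable {m : ℕ} {S : Type} {h : Set ((Fin m → Bool) × S)} {ε : ℝ}

lemma randComputes_map_ofFintype {κ : Type*} [Fintype κ] {q : κ → ℝ} (hq : ∀ j, 0 ≤ q j)
    (hq₁ : ∑ j, ENNReal.ofReal (q j) = 1) (T : κ → DecisionTree m S)
    (hT : ∀ x, 1 - ε ≤ ∑ j, {j | x ∉ (T j).errorSet h}.indicator q j) :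
    RandComputes ((PMF.ofFintype (fun j => ENNReal.ofReal (q j)) hq₁).map T) h ε := by
  intro x
  rw [PMF.toOuterMeasure_map_apply, PMF.toOuterMeasure_ofFintype_apply, tsum_fintype]
  refine (ENNReal.ofReal_le_ofReal (hT x)).trans_eq ?_
  rw [ENNReal.ofReal_sum_of_nonneg fun j _ => Set.indicator_nonneg (fun j _ => hq j) j]
  refine Finset.sum_congr rfl fun j _ => ?_
  by_cases hj : (x, (T j).output x) ∈ h <;> simp [DecisionTree.errorSet, Set.indicator, hj]

/-- Yao's principle. There may be infinitely many trees, but only finitely many error sets: these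
are the pure strategies in the game to which the minimax theorem is applied. -/
theorem randQueryComplexity_le_of_forall_distr {l : ℕ}
    (H : ∀ μ : Distr m, ∃ T : DecisionTree m S, (∀ x, T.numQueries x ≤ l) ∧
      μ.prob (T.errorSet h) ≤ ε) :
    randQueryComplexity ε h ≤ l := by
  classical
  let κ := {E : Set (Fin m → Bool) //
    ∃ T : DecisionTree m S, (∀ x, T.numQueries x ≤ l) ∧ T.errorSet h = E}
  choose T hTl hTE using fun E : κ => E.2
  let M : Matrix (Fin m → Bool) κ ℝ := fun x E => if x ∉ E.1 then 1 else 0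
  obtain ⟨q, hq, hMq⟩ : ∃ q ∈ stdSimplex ℝ κ, ∀ x, 1 - ε ≤ (M *ᵥ q) x := by
    refine exists_mem_stdSimplex_forall_le_mulVec M fun p hp => ?_
    let μ : Distr m := ⟨p, hp⟩
    obtain ⟨T, hTl, hTε⟩ := H μ
    refine ⟨⟨T.errorSet h, T, hTl, rfl⟩, ?_⟩
    calc
      1 - ε ≤ μ.prob (T.errorSet h)ᶜ := by rw [μ.prob_compl]; linarith
      _ = _ := Finset.sum_congr rfl fun x _ => by simp [M, μ, Set.indicator]
  have hq₁ : ∑ E, ENNReal.ofReal (q E) = 1 := by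
    rw [← ENNReal.ofReal_sum_of_nonneg fun E _ => hq.1 E, hq.2, ENNReal.ofReal_one]
  refine Nat.sInf_le ⟨_, randComputes_map_ofFintype hq.1 hq₁ T fun x => ?_, fun U hU => ?_⟩
  · refine (hMq x).trans_eq (Finset.sum_congr rfl fun E _ => ?_)
    simp [M, hTE, Set.indicator]
  · obtain ⟨E, -, rfl⟩ := (PMF.mem_support_map_iff _ _ _).1 hU
    exact hTl E

end Yao

namespace DecisionTree

variable {m : ℕ} {S : Type}

/-- The tree of the first `j` queries of a tree. Its leaves are unlabelled, since only the
partition of the inputs that they define is relevant. -/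
def truncate : DecisionTree m S → ℕ → DecisionTree m Unit
  | query i T₀ T₁, j + 1 => query i (T₀.truncate j) (T₁.truncate j)
  | query _ _ _, 0 => leaf ()
  | leaf _, _ => leaf ()

lemma numQueries_truncate_le (T : DecisionTree m S) (j : ℕ) (x : Fin m → Bool) :
    (T.truncate j).numQueries x ≤ j := by
  induction T generalizing j with
  | leaf _ => exact j.zero_le
  | query i T₀ T₁ ih₀ ih₁ =>
    cases j with
    | zero => exact le_rfl
    | succ j =>
      rw [truncate, numQueries]
      have h₀ := ih₀ j
      have h₁ := ih₁ j
      split_ifs <;> lia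

/-- The sum of `f C` over the subcubes `C` at the leaves of a subtree, where the second argument
is the subcube at its root. -/
def leafSum (f : Set (Fin m → Bool) → ℝ) : DecisionTree m S → Set (Fin m → Bool) → ℝ
  | leaf _, C => f C
  | query i T₀ T₁, C =>
      leafSum f T₀ (C ∩ {x | x i = false}) + leafSum f T₁ (C ∩ {x | x i = true})

lemma leafSum_nonneg {f : Set (Fin m → Bool) → ℝ} (hf : ∀ C, 0 ≤ f C) (T : DecisionTree m S)
    (C : Set (Fin m → Bool)) : 0 ≤ leafSum f T C := by
  induction T generalizing C with
  | leaf _ => exact hf C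
  | query i T₀ T₁ ih₀ ih₁ => exact add_nonneg (ih₀ _) (ih₁ _)

lemma leafSum_const_mul (c : ℝ) (f : Set (Fin m → Bool) → ℝ) (T : DecisionTree m S)
    (C : Set (Fin m → Bool)) : leafSum (fun D => c * f D) T C = c * leafSum f T C := by
  induction T generalizing C with
  | leaf _ => rfl
  | query i T₀ T₁ ih₀ ih₁ => rw [leafSum, leafSum, ih₀, ih₁, mul_add]

lemma leafSum_eq_zero_of_computes {f : Set (Fin m → Bool) → ℝ} {h : Set ((Fin m → Bool) × S)}
    (hf : ∀ C s, (∀ x ∈ C, (x, s) ∈ h) → f C = 0) {T : DecisionTree m S} (hT : T.Computes h) :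
    leafSum f T Set.univ = 0 := by
  suffices ∀ C, (∀ x ∈ C, (x, T.output x) ∈ h) → leafSum f T C = 0 from this _ fun x _ => hT x
  clear hT
  induction T with
  | leaf s => exact fun C hC => hf C s hC
  | query i T₀ T₁ ih₀ ih₁ =>
    intro C hC
    rw [leafSum, ih₀, ih₁, add_zero] <;>
    · rintro x ⟨hx, hi : x i = _⟩
      simpa [output, hi] using hC x hx

/-- The tree `F` is obtained by grafting a suitable tree onto each leaf of `T`. -/
lemma exists_prob_inter_errorSet_le_leafSum {S' : Type} {h : Set ((Fin m → Bool) × S')}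
    {μ : Distr m} {f : Set (Fin m → Bool) → ℝ} {l : ℕ}
    (hf : ∀ C, ∃ F : DecisionTree m S', (∀ x, F.numQueries x ≤ l) ∧
      μ.prob (C ∩ F.errorSet h) ≤ f C)
    (T : DecisionTree m S) (C : Set (Fin m → Bool)) :
    ∃ F : DecisionTree m S', (∀ x, F.numQueries x ≤ T.numQueries x + l) ∧
      μ.prob (C ∩ F.errorSet h) ≤ leafSum f T C := by
  induction T generalizing C with
  | leaf _ => simpa only [numQueries, leafSum, zero_add] using hf C
  | query i T₀ T₁ ih₀ ih₁ =>
    obtain ⟨F₀, hl₀, hF₀⟩ := ih₀ (C ∩ {x | x i = false})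
    obtain ⟨F₁, hl₁, hF₁⟩ := ih₁ (C ∩ {x | x i = true})
    refine ⟨query i F₀ F₁, fun x => ?_, ?_⟩
    · have h₀ := hl₀ x
      have h₁ := hl₁ x
      simp only [numQueries]
      split_ifs <;> lia
    · rw [μ.prob_inter_errorSet_query]
      exact add_le_add hF₀ hF₁

end DecisionTree

section Conflict

open DecisionTree

/-- The inequality between affinity and total variation distance, for Bernoulli distributions. -/
lemma sq_sqrt_mul_add_sqrt_mul_add_sq_sub_le {p q : ℝ} (hp : p ∈ Set.Icc 0 1)
    (hq : q ∈ Set.Icc 0 1) : (√(p * q) + √((1 - p) * (1 - q))) ^ 2 + (p - q) ^ 2 ≤ 1 := by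
  have hp' : 0 ≤ 1 - p := sub_nonneg.2 hp.2
  have hq' : 0 ≤ 1 - q := sub_nonneg.2 hq.2
  rw [Real.sqrt_mul hp.1, Real.sqrt_mul hp']
  have hsum : (√p * √q + √(1 - p) * √(1 - q)) ^ 2 + (p - q) ^ 2
      + (√p * √(1 - p) - √q * √(1 - q)) ^ 2 = 1 := by
    linear_combination (√q ^ 2 + √(1 - p) ^ 2) * (Real.sq_sqrt hp.1 + Real.sq_sqrt hq')
      + (1 + p - q) * (Real.sq_sqrt hq.1 + Real.sq_sqrt hp')
  linarith [sq_nonneg (√p * √(1 - p) - √q * √(1 - q))]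

variable {m : ℕ} (μ₀ μ₁ : Distr m)

/-- The affinity (Bhattacharyya coefficient) of `μ₀` and `μ₁` after merging the points of `C`, i.e.
the geometric mean of their weights of `C`. -/
noncomputable def affinity (C : Set (Fin m → Bool)) : ℝ := √(μ₀.prob C * μ₁.prob C)

/-- `Δ(v)` for a vertex `v` with subcube `C` at which bit `i` is queried. -/
noncomputable def gap (C : Set (Fin m → Bool)) (i : Fin m) : ℝ :=
  |μ₀.condBit C i false - μ₁.condBit C i false|

/-- The ratio `R(w) / R(v)`, where `v` is a vertex with subcube `C` at which bit `i` is queried,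
and `w` is its child for the answer `b`. -/
noncomputable def overlap (C : Set (Fin m → Bool)) (i : Fin m) (b : Bool) : ℝ :=
  min (μ₀.condBit C i b) (μ₁.condBit C i b)

/-- The sum of `Δ(v) ^ p * R(v)` over the internal vertices `v` of a subtree, where `C` and `r`
are the subcube and the `R`-value of its root. -/
noncomputable def gapMoment {S : Type} (p : ℕ) :
    DecisionTree m S → Set (Fin m → Bool) → ℝ → ℝ
  | leaf _, _, _ => 0
  | query i T₀ T₁, C, r =>
      gap μ₀ μ₁ C i ^ p * r
      + gapMoment p T₀ (C ∩ {x | x i = false}) (r * overlap μ₀ μ₁ C i false)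
      + gapMoment p T₁ (C ∩ {x | x i = true}) (r * overlap μ₀ μ₁ C i true)

variable {μ₀ μ₁}

lemma conflictSum_query (i : Fin m) (T₀ T₁ : DecisionTree m Bool) (C : Set (Fin m → Bool))
    (d : ℕ) (r : ℝ) :
    conflictSum μ₀ μ₁ (query i T₀ T₁) C d r = d * gap μ₀ μ₁ C i * r
      + conflictSum μ₀ μ₁ T₀ (C ∩ {x | x i = false}) (d + 1) (r * overlap μ₀ μ₁ C i false)
      + conflictSum μ₀ μ₁ T₁ (C ∩ {x | x i = true}) (d + 1) (r * overlap μ₀ μ₁ C i true) :=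
  rfl

lemma affinity_nonneg (C : Set (Fin m → Bool)) : 0 ≤ affinity μ₀ μ₁ C := Real.sqrt_nonneg _

lemma affinity_univ : affinity μ₀ μ₁ Set.univ = 1 := by
  rw [affinity, μ₀.prob_univ, μ₁.prob_univ, mul_one, Real.sqrt_one]

lemma prob_ne_zero_of_affinity_pos {C : Set (Fin m → Bool)} (h : 0 < affinity μ₀ μ₁ C) :
    μ₀.prob C ≠ 0 ∧ μ₁.prob C ≠ 0 :=
  mul_ne_zero_iff.1 (Real.sqrt_pos.1 h).ne'

lemma gap_nonneg (C : Set (Fin m → Bool)) (i : Fin m) : 0 ≤ gap μ₀ μ₁ C i := abs_nonneg _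

lemma overlap_nonneg (C : Set (Fin m → Bool)) (i : Fin m) (b : Bool) :
    0 ≤ overlap μ₀ μ₁ C i b :=
  le_min (μ₀.condBit_nonneg C i b) (μ₁.condBit_nonneg C i b)

lemma overlap_false_add_true {C : Set (Fin m → Bool)} (h : 0 < affinity μ₀ μ₁ C) (i : Fin m) :
    overlap μ₀ μ₁ C i false + overlap μ₀ μ₁ C i true = 1 - gap μ₀ μ₁ C i := by
  obtain ⟨h₀, h₁⟩ := prob_ne_zero_of_affinity_pos h
  have e₀ := μ₀.condBit_false_add_true h₀ i
  have e₁ := μ₁.condBit_false_add_true h₁ i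
  rw [overlap, overlap, gap, ← max_sub_min_eq_abs]
  grind

lemma affinity_inter (C : Set (Fin m → Bool)) (i : Fin m) (b : Bool) :
    affinity μ₀ μ₁ (C ∩ {x | x i = b}) =
      affinity μ₀ μ₁ C * √(μ₀.condBit C i b * μ₁.condBit C i b) := by
  rw [affinity, affinity, ← μ₀.condBit_mul_prob, ← μ₁.condBit_mul_prob,
    ← Real.sqrt_mul (mul_nonneg (μ₀.prob_nonneg _) (μ₁.prob_nonneg _)), mul_mul_mul_comm, mul_comm]

lemma overlap_le_sqrt (C : Set (Fin m → Bool)) (i : Fin m) (b : Bool) :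
    overlap μ₀ μ₁ C i b ≤ √(μ₀.condBit C i b * μ₁.condBit C i b) := by
  refine Real.le_sqrt_of_sq_le ?_
  rw [sq]
  exact mul_le_mul (min_le_left _ _) (min_le_right _ _) (overlap_nonneg C i b)
    (μ₀.condBit_nonneg C i b)

lemma affinity_inter_add_affinity_inter_le (C : Set (Fin m → Bool)) (i : Fin m) :
    affinity μ₀ μ₁ (C ∩ {x | x i = false}) + affinity μ₀ μ₁ (C ∩ {x | x i = true})
      ≤ affinity μ₀ μ₁ C * (1 - gap μ₀ μ₁ C i ^ 2 / 2) := by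
  rw [affinity_inter, affinity_inter, ← mul_add]
  rcases (affinity_nonneg C).eq_or_lt with h | hpos
  · rw [← h, zero_mul, zero_mul]
  refine mul_le_mul_of_nonneg_left ?_ hpos.le
  obtain ⟨h₀, h₁⟩ := prob_ne_zero_of_affinity_pos hpos
  have mem_Icc {μ : Distr m} (h : μ.prob C ≠ 0) : μ.condBit C i false ∈ Set.Icc 0 1 :=
    ⟨μ.condBit_nonneg C i _,
      by linarith [μ.condBit_false_add_true h i, μ.condBit_nonneg C i true]⟩
  have hbernoulli := sq_sqrt_mul_add_sqrt_mul_add_sq_sub_le (mem_Icc h₀) (mem_Icc h₁)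
  rw [← eq_sub_of_add_eq' (μ₀.condBit_false_add_true h₀ i),
    ← eq_sub_of_add_eq' (μ₁.condBit_false_add_true h₁ i)] at hbernoulli
  rw [gap, sq_abs]
  linarith [two_mul_le_add_sq (√(μ₀.condBit C i false * μ₁.condBit C i false)
    + √(μ₀.condBit C i true * μ₁.condBit C i true)) 1]

variable {S : Type} {C : Set (Fin m → Bool)} {r : ℝ}

lemma mul_overlap_mem_Icc (hr : r ∈ Set.Icc 0 (affinity μ₀ μ₁ C)) (i : Fin m) (b : Bool) :
    r * overlap μ₀ μ₁ C i b ∈ Set.Icc 0 (affinity μ₀ μ₁ (C ∩ {x | x i = b})) :=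
  ⟨mul_nonneg hr.1 (overlap_nonneg C i b), affinity_inter C i b ▸
    mul_le_mul hr.2 (overlap_le_sqrt C i b) (overlap_nonneg C i b) (affinity_nonneg C)⟩

lemma mul_overlap_false_add_true (hr : r ∈ Set.Icc 0 (affinity μ₀ μ₁ C)) (i : Fin m) :
    r * overlap μ₀ μ₁ C i false + r * overlap μ₀ μ₁ C i true = r * (1 - gap μ₀ μ₁ C i) := by
  rcases hr.1.eq_or_lt with rfl | hpos
  · simp only [zero_mul, add_zero]
  · rw [← mul_add, overlap_false_add_true (hpos.trans_le hr.2)]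

lemma leafSum_affinity_add_gapMoment_two_le (T : DecisionTree m S)
    (hr : r ∈ Set.Icc 0 (affinity μ₀ μ₁ C)) :
    leafSum (affinity μ₀ μ₁) T C + gapMoment μ₀ μ₁ 2 T C r / 2 ≤ affinity μ₀ μ₁ C := by
  induction T generalizing C r with
  | leaf _ => simp only [leafSum, gapMoment, zero_div, add_zero, le_refl]
  | query i T₀ T₁ ih₀ ih₁ =>
    have h₀ := ih₀ (mul_overlap_mem_Icc hr i false)
    have h₁ := ih₁ (mul_overlap_mem_Icc hr i true)
    have haff := affinity_inter_add_affinity_inter_le (μ₀ := μ₀) (μ₁ := μ₁) C i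
    have hgap := mul_le_mul_of_nonneg_left hr.2 (sq_nonneg (gap μ₀ μ₁ C i))
    rw [leafSum, gapMoment]
    linarith

lemma gapMoment_zero_truncate_le (T : DecisionTree m S) (j : ℕ)
    (hr : r ∈ Set.Icc 0 (affinity μ₀ μ₁ C)) :
    gapMoment μ₀ μ₁ 0 (T.truncate j) C r ≤ j * r := by
  induction T generalizing j C r with
  | leaf _ => exact mul_nonneg j.cast_nonneg hr.1
  | query i T₀ T₁ ih₀ ih₁ =>
    cases j with
    | zero => rw [truncate, gapMoment, Nat.cast_zero, zero_mul]
    | succ j =>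
      have h₀ := ih₀ j (mul_overlap_mem_Icc hr i false)
      have h₁ := ih₁ j (mul_overlap_mem_Icc hr i true)
      have hloss : 0 ≤ j * (r * gap μ₀ μ₁ C i) :=
        mul_nonneg j.cast_nonneg (mul_nonneg hr.1 (gap_nonneg C i))
      rw [truncate, gapMoment, pow_zero, one_mul]
      push_cast
      linear_combination h₀ + h₁ + hloss + (j : ℝ) * mul_overlap_false_add_true hr i

lemma two_mul_mul_gapMoment_one_le (t : ℝ) (T : DecisionTree m S) (C : Set (Fin m → Bool))
    (hr : 0 ≤ r) :
    2 * t * gapMoment μ₀ μ₁ 1 T C r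
      ≤ t ^ 2 * gapMoment μ₀ μ₁ 0 T C r + gapMoment μ₀ μ₁ 2 T C r := by
  induction T generalizing C r with
  | leaf _ => simp only [gapMoment, mul_zero, add_zero, le_refl]
  | query i T₀ T₁ ih₀ ih₁ =>
    have h₀ := ih₀ (C ∩ {x | x i = false})
      (mul_nonneg hr (overlap_nonneg (μ₀ := μ₀) (μ₁ := μ₁) C i false))
    have h₁ := ih₁ (C ∩ {x | x i = true})
      (mul_nonneg hr (overlap_nonneg (μ₀ := μ₀) (μ₁ := μ₁) C i true))
    have hv := mul_le_mul_of_nonneg_right (two_mul_le_add_sq t (gap μ₀ μ₁ C i)) hr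
    simp only [gapMoment]
    linarith

/-- The `R`-mass lost in the first `j` levels is `∑ Δ(v) R(v)`, while the mass that survives them
can only be lost at depth at least `d + j`. -/
lemma mul_le_mul_gapMoment_one_truncate_add_conflictSum (T : DecisionTree m Bool) (d j : ℕ)
    (hr : r ∈ Set.Icc 0 (affinity μ₀ μ₁ C)) (hT : leafSum (affinity μ₀ μ₁) T C = 0) :
    (d + j) * r
      ≤ (d + j) * gapMoment μ₀ μ₁ 1 (T.truncate j) C r + conflictSum μ₀ μ₁ T C d r := by
  induction T generalizing d j C r with
  | leaf _ =>
    have hr₀ : r = 0 := le_antisymm (hr.2.trans_eq hT) hr.1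
    simp only [truncate, gapMoment, conflictSum, hr₀, mul_zero, add_zero, le_refl]
  | query i T₀ T₁ ih₀ ih₁ =>
    have hr₀ := mul_overlap_mem_Icc hr i false
    have hr₁ := mul_overlap_mem_Icc hr i true
    obtain ⟨hT₀, hT₁⟩ := (add_eq_zero_iff_of_nonneg (leafSum_nonneg affinity_nonneg T₀ _)
      (leafSum_nonneg affinity_nonneg T₁ _)).1 hT
    have hsum := mul_overlap_false_add_true hr i
    rw [conflictSum_query]
    cases j with
    | zero =>
      have h₀ := ih₀ (d + 1) 0 hr₀ hT₀
      have h₁ := ih₁ (d + 1) 0 hr₁ hT₁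
      have htrunc (T : DecisionTree m Bool) (C r) : gapMoment μ₀ μ₁ 1 (T.truncate 0) C r = 0 := by
        cases T <;> rfl
      rw [htrunc] at h₀ h₁ ⊢
      push_cast at h₀ h₁ ⊢
      linear_combination h₀ + h₁ + hr₀.1 + hr₁.1 - (d : ℝ) * hsum
    | succ j =>
      have h₀ := ih₀ (d + 1) j hr₀ hT₀
      have h₁ := ih₁ (d + 1) j hr₁ hT₁
      have hroot : 0 ≤ d * (gap μ₀ μ₁ C i * r) :=
        mul_nonneg d.cast_nonneg (mul_nonneg (gap_nonneg C i) hr.1)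
      rw [truncate, gapMoment, pow_one]
      push_cast at h₀ h₁ ⊢
      linear_combination h₀ + h₁ + hroot - ((d : ℝ) + 1 + j) * hsum

lemma one_le_treeConflict {T : DecisionTree m Bool}
    (hT : leafSum (affinity μ₀ μ₁) T Set.univ = 0) : 1 ≤ treeConflict T μ₀ μ₁ := by
  have h := mul_le_mul_gapMoment_one_truncate_add_conflictSum T 1 0
    ⟨zero_le_one, affinity_univ.ge⟩ hT
  cases T <;> simpa [treeConflict, truncate, gapMoment] using h

lemma leafSum_affinity_truncate_le {k : ℕ} (hk : 0 < k) {T : DecisionTree m Bool}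
    (hT : leafSum (affinity μ₀ μ₁) T Set.univ = 0) (hTk : treeConflict T μ₀ μ₁ ≤ (k + 1) / 2) :
    leafSum (affinity μ₀ μ₁) (T.truncate k) Set.univ ≤ 1 - 1 / (8 * k) := by
  have hk' : (0 : ℝ) < k := Nat.cast_pos.2 hk
  have hr : (1 : ℝ) ∈ Set.Icc 0 (affinity μ₀ μ₁ Set.univ) := ⟨zero_le_one, affinity_univ.ge⟩
  have hloss := leafSum_affinity_add_gapMoment_two_le (T.truncate k) hr
  have hmass := gapMoment_zero_truncate_le T k hr
  have hgap : 1 / 2 ≤ gapMoment μ₀ μ₁ 1 (T.truncate k) Set.univ 1 := by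
    have h := mul_le_mul_gapMoment_one_truncate_add_conflictSum T 1 k hr hT
    rw [treeConflict] at hTk
    push_cast at h
    nlinarith
  have hsq : 1 / (4 * k) ≤ gapMoment μ₀ μ₁ 2 (T.truncate k) Set.univ 1 := by
    have h := two_mul_mul_gapMoment_one_le (μ₀ := μ₀) (μ₁ := μ₁) (1 / (2 * k)) (T.truncate k)
      Set.univ zero_le_one
    have h₁ := mul_le_mul_of_nonneg_left hgap (show 0 ≤ 2 * (1 / (2 * (k : ℝ))) by positivity)
    have h₀ := mul_le_mul_of_nonneg_left hmass (sq_nonneg (1 / (2 * (k : ℝ))))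
    have hk₄ : 1 / (4 * (k : ℝ)) = 2 * (1 / (2 * k)) * (1 / 2) - (1 / (2 * k)) ^ 2 * (k * 1) := by
      field_simp
      norm_num
    linarith
  have hk₈ : 1 / (8 * (k : ℝ)) = 1 / (4 * k) / 2 := by
    field_simp
    norm_num
  rw [affinity_univ] at hloss
  linarith

lemma sqrt_mul_affinity_cond (μ : Distr m) {A B : Set (Fin m → Bool)} (hA : μ.prob A ≠ 0)
    (hB : μ.prob B ≠ 0) (C : Set (Fin m → Bool)) :
    √(μ.prob A * μ.prob B) * affinity (μ.cond A hA) (μ.cond B hB) C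
      = √(μ.prob (C ∩ A) * μ.prob (C ∩ B)) := by
  rw [affinity, ← Real.sqrt_mul (mul_nonneg (μ.prob_nonneg A) (μ.prob_nonneg B)),
    mul_mul_mul_comm, μ.prob_mul_prob_cond hA, μ.prob_mul_prob_cond hB]

end Conflict

section Rounds

open DecisionTree

variable {m : ℕ} {g : Set ((Fin m → Bool) × Bool)}

lemma IsPartialBoolFun.errorSet_leaf_subset (hg : IsPartialBoolFun g) (s : Bool) :
    (leaf s).errorSet g ⊆ validPreimage g !s := by
  intro x (hx : (x, s) ∉ g)
  have hvalid : x ∈ validPreimage g false ∪ validPreimage g true := by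
    by_contra hinvalid
    obtain ⟨h₀, h₁⟩ := hg x hinvalid
    cases s <;> contradiction
  cases s
  · exact hvalid.resolve_left fun h => hx h.1
  · exact hvalid.resolve_right fun h => hx h.1

lemma exists_prob_errorSet_leaf_le (hg : IsPartialBoolFun g) (μ : Distr m) :
    ∃ s, μ.prob ((leaf s).errorSet g)
      ≤ √(μ.prob (validPreimage g false) * μ.prob (validPreimage g true)) := by
  have herr (s : Bool) := μ.prob_mono (hg.errorSet_leaf_subset s)
  have hnonneg (b : Bool) := μ.prob_nonneg (validPreimage g b)
  rcases le_total (μ.prob (validPreimage g false)) (μ.prob (validPreimage g true)) with h | h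
  · exact ⟨true, (herr true).trans <| Real.le_sqrt_of_sq_le <|
      sq (μ.prob _) ▸ mul_le_mul_of_nonneg_left h (hnonneg false)⟩
  · exact ⟨false, (herr false).trans <| Real.le_sqrt_of_sq_le <|
      sq (μ.prob _) ▸ mul_le_mul_of_nonneg_right h (hnonneg true)⟩

lemma leafSum_affinity_eq_zero {μ₀ μ₁ : Distr m} (h₀ : μ₀.SupportedOn (validPreimage g false))
    (h₁ : μ₁.SupportedOn (validPreimage g true)) {T : DecisionTree m Bool} (hT : T.Computes g) :
    leafSum (affinity μ₀ μ₁) T Set.univ = 0 := by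
  have disjoint {C : Set (Fin m → Bool)} {s : Bool} (hC : ∀ x ∈ C, (x, !s) ∈ g) :
      Disjoint (validPreimage g s) C :=
    Set.disjoint_left.2 fun x hx hxC => hx.2 (hC x hxC)
  refine leafSum_eq_zero_of_computes (fun C s hC => ?_) hT
  cases s with
  | false => rw [affinity, h₁.prob_eq_zero (disjoint hC), mul_zero, Real.sqrt_zero]
  | true => rw [affinity, h₀.prob_eq_zero (disjoint hC), zero_mul, Real.sqrt_zero]

lemma exists_prob_inter_errorSet_le_of_forall_distr {S : Type} {h : Set ((Fin m → Bool) × S)}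
    {A B : Set (Fin m → Bool)} {c : ℝ} (hc : 0 ≤ c) {l : ℕ}
    (H : ∀ μ : Distr m, ∃ F : DecisionTree m S, (∀ x, F.numQueries x ≤ l) ∧
      μ.prob (F.errorSet h) ≤ c * √(μ.prob A * μ.prob B))
    (μ : Distr m) (C : Set (Fin m → Bool)) :
    ∃ F : DecisionTree m S, (∀ x, F.numQueries x ≤ l) ∧
      μ.prob (C ∩ F.errorSet h) ≤ c * √(μ.prob (C ∩ A) * μ.prob (C ∩ B)) := by
  by_cases hC : μ.prob C = 0
  · obtain ⟨F, hl, -⟩ := H μ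
    exact ⟨F, hl, (μ.prob_mono Set.inter_subset_left).trans
      (hC.trans_le (mul_nonneg hc (Real.sqrt_nonneg _)))⟩
  obtain ⟨F, hl, hF⟩ := H (μ.cond C hC)
  refine ⟨F, hl, ?_⟩
  have hinter (D : Set (Fin m → Bool)) : μ.prob (C ∩ D) = μ.prob C * (μ.cond C hC).prob D := by
    rw [μ.prob_mul_prob_cond, Set.inter_comm]
  rw [hinter, hinter, hinter, mul_mul_mul_comm, Real.sqrt_mul (mul_self_nonneg _),
    Real.sqrt_mul_self (μ.prob_nonneg C), mul_left_comm]
  exact mul_le_mul_of_nonneg_left hF (μ.prob_nonneg C)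

lemma exists_prob_errorSet_le_pow (hg : IsPartialBoolFun g) {k : ℕ} (hk : 0 < k)
    (H : ∀ μ₀ μ₁ : Distr m, μ₀.SupportedOn (validPreimage g false) →
      μ₁.SupportedOn (validPreimage g true) →
      ∃ T : DecisionTree m Bool, T.Computes g ∧ treeConflict T μ₀ μ₁ ≤ (k + 1) / 2)
    (n : ℕ) (μ : Distr m) :
    ∃ F : DecisionTree m Bool, (∀ x, F.numQueries x ≤ n * k) ∧
      μ.prob (F.errorSet g) ≤ (1 - 1 / (8 * k)) ^ n *
        √(μ.prob (validPreimage g false) * μ.prob (validPreimage g true)) := by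
  have hθ : (0 : ℝ) ≤ 1 - 1 / (8 * k) := by
    have hk' : (1 : ℝ) ≤ k := by exact_mod_cast hk
    rw [sub_nonneg, div_le_one (by linarith)]
    linarith
  induction n generalizing μ with
  | zero =>
    obtain ⟨s, hs⟩ := exists_prob_errorSet_leaf_le hg μ
    exact ⟨leaf s, fun _ => Nat.zero_le _, by rwa [pow_zero, one_mul]⟩
  | succ n ih =>
    by_cases hμ : μ.prob (validPreimage g false) * μ.prob (validPreimage g true) = 0
    · obtain ⟨s, hs⟩ := exists_prob_errorSet_leaf_le hg μ
      exact ⟨leaf s, fun _ => Nat.zero_le _, by rw [hμ, Real.sqrt_zero] at hs ⊢; rwa [mul_zero]⟩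
    obtain ⟨hμ₀, hμ₁⟩ := mul_ne_zero_iff.1 hμ
    have h₀ := μ.supportedOn_cond hμ₀
    have h₁ := μ.supportedOn_cond hμ₁
    obtain ⟨T, hT, hTk⟩ := H _ _ h₀ h₁
    have hround := leafSum_affinity_truncate_le hk (leafSum_affinity_eq_zero h₀ h₁ hT) hTk
    obtain ⟨F, hFl, hF⟩ := exists_prob_inter_errorSet_le_leafSum
      (exists_prob_inter_errorSet_le_of_forall_distr (pow_nonneg hθ n) ih μ) (T.truncate k) Set.univ
    refine ⟨F, fun x => (hFl x).trans ?_, ?_⟩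
    · rw [add_one_mul, add_comm]
      exact Nat.add_le_add_left (T.numQueries_truncate_le k x) _
    · simp only [← sqrt_mul_affinity_cond μ hμ₀ hμ₁, leafSum_const_mul, Set.univ_inter] at hF
      refine hF.trans ?_
      rw [pow_succ, mul_assoc, mul_comm (1 - 1 / (8 * (k : ℝ)))]
      gcongr

end Rounds

section Complexity

variable {m : ℕ} {g : Set ((Fin m → Bool) × Bool)}

lemma randQueryComplexity_eq_zero_of_validPreimage_eq_empty (hg : IsPartialBoolFun g) {b : Bool}
    (hb : validPreimage g b = ∅) {ε : ℝ} (hε : 0 ≤ ε) : randQueryComplexity ε g = 0 := by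
  refine Nat.le_zero.1 (randQueryComplexity_le_of_forall_distr fun μ =>
    ⟨.leaf !b, fun _ => le_rfl, ?_⟩)
  have hempty : (DecisionTree.leaf !b).errorSet g = ∅ :=
    Set.subset_empty_iff.1 ((hg.errorSet_leaf_subset !b).trans_eq (by rw [Bool.not_not, hb]))
  simpa only [hempty, Distr.prob, Set.indicator_empty, Finset.sum_const_zero] using hε

lemma one_sub_pow_le_third {k : ℕ} (hk : 0 < k) : (1 - 1 / (8 * k : ℝ)) ^ (16 * k) ≤ 1 / 3 := by
  have hk' : (1 : ℝ) ≤ k := by exact_mod_cast hk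
  have hfrac : 1 - 1 / (8 * k : ℝ) = 1 - 2 / (16 * k : ℕ) := by
    push_cast
    field_simp
    ring
  calc
    (1 - 1 / (8 * k : ℝ)) ^ (16 * k) ≤ Real.exp (-2) := by
      rw [hfrac]
      exact Real.one_sub_div_pow_le_exp_neg (by push_cast; linarith)
    _ ≤ 1 / 3 := by
      rw [Real.exp_neg, one_div]
      exact inv_anti₀ three_pos (by linarith [Real.add_one_le_exp (2 : ℝ)])

lemma randQueryComplexity_le_of_treeConflict_le (hg : IsPartialBoolFun g) {k : ℕ} (hk : 0 < k)
    (H : ∀ μ₀ μ₁ : Distr m, μ₀.SupportedOn (validPreimage g false) →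
      μ₁.SupportedOn (validPreimage g true) →
      ∃ T : DecisionTree m Bool, T.Computes g ∧ treeConflict T μ₀ μ₁ ≤ (k + 1) / 2) :
    randQueryComplexity (1 / 3) g ≤ 16 * k * k := by
  refine randQueryComplexity_le_of_forall_distr fun μ => ?_
  obtain ⟨F, hFl, hF⟩ := exists_prob_errorSet_le_pow hg hk H (16 * k) μ
  have hsqrt : √(μ.prob (validPreimage g false) * μ.prob (validPreimage g true)) ≤ 1 :=
    Real.sqrt_le_one.2 (mul_le_one₀ (μ.prob_le_one _) (μ.prob_nonneg _) (μ.prob_le_one _))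
  exact ⟨F, hFl, hF.trans <| (mul_le_mul (one_sub_pow_le_third hk) hsqrt (Real.sqrt_nonneg _)
    (by norm_num)).trans_eq (mul_one _)⟩

lemma one_le_conflictComplexity (h₀ : (validPreimage g false).Nonempty)
    (h₁ : (validPreimage g true).Nonempty) : 1 ≤ conflictComplexity g := by
  have hμ₀ := Distr.supportedOn_dirac h₀.some_mem
  have hμ₁ := Distr.supportedOn_dirac h₁.some_mem
  refine le_iSup₂_of_le _ _ (le_iSup₂_of_le hμ₀ hμ₁ (le_iInf₂ fun T hT => ?_))
  exact ENNReal.one_le_ofReal.2 (one_le_treeConflict (leafSum_affinity_eq_zero hμ₀ hμ₁ hT))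

lemma exists_treeConflict_lt_of_conflictComplexity_lt {D : ℝ}
    (hD : conflictComplexity g < ENNReal.ofReal D) {μ₀ μ₁ : Distr m}
    (h₀ : μ₀.SupportedOn (validPreimage g false)) (h₁ : μ₁.SupportedOn (validPreimage g true)) :
    ∃ T : DecisionTree m Bool, T.Computes g ∧ treeConflict T μ₀ μ₁ < D := by
  have hinf : (⨅ (T : DecisionTree m Bool) (_ : T.Computes g),
      ENNReal.ofReal (treeConflict T μ₀ μ₁)) < ENNReal.ofReal D :=
    (le_iSup₂_of_le μ₀ μ₁ (le_iSup₂ (α := ENNReal) h₀ h₁)).trans_lt hD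
  simp only [iInf_lt_iff] at hinf
  obtain ⟨T, hT, hlt⟩ := hinf
  exact ⟨T, hT, lt_of_not_ge fun hge => hlt.not_ge (ENNReal.ofReal_le_ofReal hge)⟩

lemma randQueryComplexity_lt_of_conflictComplexity_lt (hg : IsPartialBoolFun g) {D : ℝ}
    (hD : conflictComplexity g < ENNReal.ofReal D) :
    (randQueryComplexity (1 / 3) g : ℝ) < (12 * D) ^ 2 := by
  have hD₀ : 0 < D := ENNReal.ofReal_pos.1 (bot_le.trans_lt hD)
  by_cases hempty : ∃ b, validPreimage g b = ∅
  · obtain ⟨b, hb⟩ := hempty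
    rw [randQueryComplexity_eq_zero_of_validPreimage_eq_empty hg hb (by norm_num), Nat.cast_zero]
    positivity
  have hne (b : Bool) : (validPreimage g b).Nonempty :=
    Set.nonempty_iff_ne_empty.2 fun h => hempty ⟨b, h⟩
  have hD₁ : 1 < D :=
    ENNReal.one_lt_ofReal.1 ((one_le_conflictComplexity (hne false) (hne true)).trans_lt hD)
  have hk : (⌈2 * D⌉₊ : ℝ) < 3 * D := by
    linarith [Nat.ceil_lt_add_one (show 0 ≤ 2 * D by linarith)]
  have hR := randQueryComplexity_le_of_treeConflict_le hg
    (Nat.ceil_pos.2 (by linarith : 0 < 2 * D)) fun μ₀ μ₁ h₀ h₁ => by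
      obtain ⟨T, hT, hlt⟩ := exists_treeConflict_lt_of_conflictComplexity_lt hD h₀ h₁
      exact ⟨T, hT, by linarith [Nat.le_ceil (2 * D)]⟩
  calc
    (randQueryComplexity (1 / 3) g : ℝ) ≤ 16 * ⌈2 * D⌉₊ * ⌈2 * D⌉₊ := by exact_mod_cast hR
    _ = 16 * (⌈2 * D⌉₊ : ℝ) ^ 2 := by ring
    _ < 16 * (3 * D) ^ 2 := by gcongr
    _ = (12 * D) ^ 2 := by ring

lemma ofReal_sqrt_randQueryComplexity_le_conflictComplexity (hg : IsPartialBoolFun g) :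
    ENNReal.ofReal (1 / 12 * √(randQueryComplexity (1 / 3) g : ℝ)) ≤ conflictComplexity g := by
  by_contra! hlt
  refine (randQueryComplexity_lt_of_conflictComplexity_lt hg hlt).ne ?_
  rw [← mul_assoc, mul_one_div_cancel (by norm_num), one_mul, Real.sq_sqrt (Nat.cast_nonneg _)]

lemma conflictComplexity_le_maxConflictComplexity (g : Set ((Fin m → Bool) × Bool)) :
    conflictComplexity g ≤ maxConflictComplexity g := by
  refine iSup₂_le fun μ₀ μ₁ => iSup₂_le fun h₀ h₁ => ?_
  let Q : ProbabilityMeasure (Distr m × Distr m) := ⟨Measure.dirac (μ₀, μ₁), inferInstance⟩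
  have hQ : ConsistentWith Q g := by
    change ∀ᵐ p ∂Measure.dirac (μ₀, μ₁), _
    rw [ae_dirac_eq]
    exact ⟨h₀, h₁⟩
  exact le_iSup₂_of_le Q hQ (iInf₂_mono fun T _ => (lintegral_dirac _ _).ge)

end Complexity

theorem theorem1 :
    ∃ c : ℝ, 0 < c ∧ ∀ (m : ℕ) (g : Set ((Fin m → Bool) × Bool)), IsPartialBoolFun g →
      ENNReal.ofReal (c * √(randQueryComplexity (1 / 3) g : ℝ)) ≤ conflictComplexity g ∧
      ENNReal.ofReal (c * √(randQueryComplexity (1 / 3) g : ℝ)) ≤ maxConflictComplexity g := by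
  refine ⟨1 / 12, by norm_num, fun m g hg => ?_⟩
  have hχ := ofReal_sqrt_randQueryComplexity_le_conflictComplexity hg
  exact ⟨hχ, hχ.trans (conflictComplexity_le_maxConflictComplexity g)⟩
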